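/- Let $\mu$ be a measure on a measurable space $(\Omega,\mathcal F)$ and let $\mathcal M_\mu$ be the set of probability measures on $(\Omega,\mathcal F)$ that have a density with respect to $\mu$; the density of $P$, $Q$, … is written $p$, $q$, …. Let $q',q''$ be measurable functions on $\Omega$ with values in $[0,\infty]$ such that $$0\le q'\le q'',\qquad \int q'\,\mathrm d\mu\le 1,\qquad \int q''\,\mathrm d\mu\ge 1,$$ and let $\mathcal Q^{=}=\{Q\in\mathcal M_\mu : q'\le q\le q''\ \ \mu\text{-a.e.}\}$ be the corresponding band class. For a convex function $f$ on $[0,\infty)$ with $f(1)=0$, real-valued on $(0,\infty)$ and with $f(0)\in(-\infty,\infty]$, and for $P_0,P_1\in\mathcal M_\mu$, the $f$-divergence is $$D_f(P_0\|P_1)=\int_{\{p_1>0\}} f\!\left(\frac{p_0}{p_1}\right)\mathrm dP_1+f'(\infty)\,P_0[p_1=0]\in(-\infty,\infty],\qquad f'(\infty)=\lim_{s\to\infty}\frac{f(s)}{s},$$ with the convention $0\cdot\infty=0$. Let $P\in\mathcal M_\mu$ have density $p$, and suppose that for some $c\in[0,\infty)$ there is a probability measure $Q^*$ with density $$q^*=\min\{q'',\max\{c\,p,\,q'\}\}$$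 with respect to $\mu$. Then: 1. $Q^*$ is unique: if, for some $c'\in[0,\infty)$, $Q$ is a probability measure with density $\min\{q'',\max\{c'p,q'\}\}$, then $Q=Q^*$. 2. $Q^*\in\mathcal Q^{=}$, and for every such convex function $f$ and every $Q\in\mathcal Q^{=}$, $$D_f(P\|Q^*)\le D_f(P\|Q)\qquad\text{and}\qquad D_f(Q^*\|P)\le D_f(Q\|P).$$ 3. $Q^*$ is the unique such minimizer: if $Q\in\mathcal Q^{=}$ minimizes $D_f(P\|\cdot)$ over $\mathcal Q^{=}$ for every such $f$, or minimizes $D_f(\cdot\|P)$ over $\mathcal Q^{=}$ for every such $f$, then $Q=Q^*$. -/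

import Mathlib

open MeasureTheory Filter
open scoped ENNReal NNReal

namespace BandModel

variable {Ω : Type*} [MeasurableSpace Ω]

/-- `P` is a probability distribution with density `p` with respect to `μ`. -/
structure HasDensity (μ P : Measure Ω) (p : Ω → ℝ≥0∞) : Prop where
  isProbabilityMeasure : IsProbabilityMeasure P
  measurable : Measurable p
  eq_withDensity : P = μ.withDensity p

/-- Admissible lower and upper bounds `qL ≤ qU` of a density band: the lower bound has mass at
most one, the upper bound has mass at least one (its mass, and its values, may be infinite). -/
structure IsBand (μ : Measure Ω) (qL qU : Ω → ℝ≥0∞) : Prop where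
  measurable_lower : Measurable qL
  measurable_upper : Measurable qU
  le : ∀ x, qL x ≤ qU x
  lower_mass : ∫⁻ x, qL x ∂μ ≤ 1
  upper_mass : 1 ≤ ∫⁻ x, qU x ∂μ

/-- The band class: all probability distributions having a density `q` with respect to `μ` such
that `qL ≤ q ≤ qU`. -/
def band (μ : Measure Ω) (qL qU : Ω → ℝ≥0∞) : Set (Measure Ω) :=
  {Q | ∃ q, HasDensity μ Q q ∧ ∀ᵐ x ∂μ, qL x ≤ q x ∧ q x ≤ qU x}

/-- The function `min {qU, max {c * p, qL}}`. -/
noncomputable def clip (qL qU p : Ω → ℝ≥0∞) (c : ℝ≥0) : Ω → ℝ≥0∞ :=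
  fun x => min (qU x) (max ((c : ℝ≥0∞) * p x) (qL x))

/-- Generators of `f`-divergences: convex functions `f` on `[0, ∞)` with `f 1 = 0` that are
real-valued on `(0, ∞)`; the value at `0` may be `+∞` (as for `f s = - log s`). -/
structure IsGenerator (f : ℝ≥0 → EReal) : Prop where
  ne_bot : ∀ s, f s ≠ ⊥
  ne_top : ∀ s, 0 < s → f s ≠ ⊤
  convex : ∀ s t a b : ℝ≥0, a + b = 1 →
    f (a * s + b * t) ≤ ((a : ℝ) : EReal) * f s + ((b : ℝ) : EReal) * f t
  map_one : f 1 = 0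

/-- Integral of an extended real-valued function: integral of the positive part minus integral of
the negative part. (In the divergence below the latter is finite, so `∞ - ∞` does not occur.) -/
noncomputable def eintegral (ν : Measure Ω) (g : Ω → EReal) : EReal :=
  ((∫⁻ x, (g x).toENNReal ∂ν : ℝ≥0∞) : EReal) - ((∫⁻ x, (- g x).toENNReal ∂ν : ℝ≥0∞) : EReal)

/-- `f'(∞) = lim_{s → ∞} f s / s`, an extended real number. (The limit exists for convex `f`; it is
written as an upper limit, which is always defined.) -/
noncomputable def slopeAtTop (f : ℝ≥0 → EReal) : EReal :=
  limsup (fun s : ℝ≥0 => f s / ((s : ℝ) : EReal)) atTop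

/-- The `f`-divergence `D_f(P‖Q) = ∫_{q > 0} f (p / q) dQ + f'(∞) P[q = 0]` of two distributions
with densities `p`, `q` with respect to `μ`; the convention is `0 * ∞ = 0`. -/
noncomputable def fDiv (μ : Measure Ω) (f : ℝ≥0 → EReal) (P Q : Measure Ω) : EReal :=
  eintegral (Q.restrict {x | 0 < Q.rnDeriv μ x})
      (fun x => f (P.rnDeriv μ x / Q.rnDeriv μ x).toNNReal)
    + slopeAtTop f * ((P {x | Q.rnDeriv μ x = 0} : ℝ≥0∞) : EReal)

end BandModel

/-!
Let `s₀ = c⁻¹` for `D_f(P‖·)` and `s₀ = c` for `D_f(·‖P)`. Subtracting a supporting line at `s₀`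
writes `f s = g s + (a * s + b)` with a convex `g ≥ 0` such that `g s₀ = 0`, and the divergence of
distributions with densities `u`, `v` becomes `∫ v * g (u / v) dμ + (a + b)`. The perspective
`(u, v) ↦ v * g (u / v)` is jointly convex and vanishes on the ray `u = s₀ * v`; hence, with `p`
fixed, the integrand is a convex function of the other density which vanishes at `c * p`. Since
`min {qU, max {c * p, qL}}` lies between `c * p` and every density in the band, it minimizes the
integrand pointwise. When `g` vanishes only at `s₀` and the divergence is finite, as for
`f s = |s - s₀| - |1 - s₀|`, a minimizer must agree with it almost everywhere. For `c = 0` it lies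
below every density in the band, so that the band consists of one distribution.
-/

namespace BandModel

section Convex

variable {E : Type*} [AddCommMonoid E] [Module ℝ≥0 E] {h : E → ℝ≥0∞} {a v w : E}

theorem le_of_convexOn_of_mem_segment (hh : ConvexOn ℝ≥0 Set.univ h) (ha : h a = 0)
    (hv : v ∈ segment ℝ≥0 a w) : h v ≤ h w :=
  ((hh.convex_le (h w)).segment_subset (x := a) (y := w) (by simp [ha]) (by simp) hv).2

theorem eq_of_convexOn_of_mem_segment_of_le (hh : ConvexOn ℝ≥0 Set.univ h)
    (ha : ∀ x, h x = 0 ↔ x = a) (hv : v ∈ segment ℝ≥0 a w) (hfin : h v ≠ ∞) (hle : h w ≤ h v) :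
    v = w := by
  have heq : h v = h w := (le_of_convexOn_of_mem_segment hh ((ha a).2 rfl) hv).antisymm hle
  by_cases hw : h w = 0
  · rw [(ha w).1 hw, (ha v).1 (heq.trans hw)]
  obtain ⟨α, β, hα, hβ, hαβ, rfl⟩ := hv
  have hle_smul : 1 * h w ≤ β * h w := by
    simpa [(ha a).2 rfl, heq, ENNReal.smul_def] using
      hh.2 (Set.mem_univ a) (Set.mem_univ w) hα hβ hαβ
  have hβ_ge : 1 ≤ β := by
    exact_mod_cast (ENNReal.mul_le_mul_iff_left hw (heq ▸ hfin)).1 hle_smul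
  have hβ_eq : β = 1 := le_antisymm (hαβ ▸ le_add_self) hβ_ge
  have hα_eq : α = 0 := by simpa [hβ_eq] using hαβ
  simp [hα_eq, hβ_eq]

variable {g : ℝ≥0 → ℝ≥0∞}

theorem measurable_of_convexOn (hg : ConvexOn ℝ≥0 Set.univ g) : Measurable g := by
  refine measurable_of_Iic fun r => Set.OrdConnected.measurableSet ⟨fun x hx y hy => ?_⟩
  have hconv : Convex ℝ≥0 (g ⁻¹' Set.Iic r) := by
    simpa [Set.preimage, Set.Iic] using hg.convex_le r
  exact NNReal.Icc_subset_segment.trans (hconv.segment_subset hx hy)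

/-- The limit of `g s / s` as `s → ∞`, that is, the slope of the recession function of a convex
function `g` on `[0, ∞)`. It is written as an upper limit, which is always defined. -/
noncomputable def recessionSlope (g : ℝ≥0 → ℝ≥0∞) : ℝ≥0∞ :=
  limsup (fun s : ℝ≥0 => g s / s) atTop

theorem le_add_mul_of_recessionSlope_lt (hg : ConvexOn ℝ≥0 Set.univ g) (s t : ℝ≥0) {M : ℝ≥0}
    (hM : recessionSlope g < M) : g (s + t) ≤ g s + M * t := by
  -- `s + t` is the mean of `s` and `s + t * n` with weights `1 - n⁻¹` and `n⁻¹`; let `n → ∞`.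
  rcases eq_or_ne t 0 with rfl | ht
  · simp
  have hinv : Tendsto (fun n : ℝ≥0 => n⁻¹) atTop (nhds 0) := tendsto_inv_atTop_zero
  have hlim : Tendsto (fun n : ℝ≥0 => g s + (M * (n⁻¹ * s + t) : ℝ≥0)) atTop
      (nhds (g s + M * t)) := by
    simpa using (ENNReal.tendsto_coe.2
      (((hinv.mul_const s).add_const t).const_mul M)).const_add (g s)
  have hatTop : Tendsto (fun n : ℝ≥0 => s + t * n) atTop atTop :=
    tendsto_atTop_mono (fun _ => le_add_self)
      (tendsto_id.const_mul_atTop (pos_iff_ne_zero.2 ht))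
  refine ge_of_tendsto hlim ?_
  filter_upwards [hatTop.eventually (eventually_lt_of_limsup_lt hM), eventually_ge_atTop 1]
    with n hn hn_one
  have hn_ne : n ≠ 0 := (zero_lt_one.trans_le hn_one).ne'
  have hg_le : g (s + t * n) ≤ (M * (s + t * n) : ℝ≥0) := by
    have hpos : s + t * n ≠ 0 := by positivity
    simpa using
      ((ENNReal.div_lt_iff (.inl (by exact_mod_cast hpos)) (.inl ENNReal.coe_ne_top)).1 hn).le
  obtain ⟨α, hα⟩ := exists_add_of_le (inv_le_one_of_one_le₀ hn_one)
  have hcomb : α • s + n⁻¹ • (s + t * n) = s + t := by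
    calc α • s + n⁻¹ • (s + t * n) = (n⁻¹ + α) * s + t * (n⁻¹ * n) := by
          simp only [smul_eq_mul]; ring
      _ = s + t := by rw [← hα, inv_mul_cancel₀ hn_ne, one_mul, mul_one]
  have hα_le : α ≤ 1 := hα ▸ le_add_self
  calc g (s + t) = g (α • s + n⁻¹ • (s + t * n)) := by rw [hcomb]
    _ ≤ α • g s + n⁻¹ • g (s + t * n) :=
        hg.2 (Set.mem_univ _) (Set.mem_univ _) zero_le zero_le (by rw [add_comm, ← hα])
    _ ≤ (1 : ℝ≥0) • g s + n⁻¹ • ((M * (s + t * n) : ℝ≥0) : ℝ≥0∞) := by gcongr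
    _ = g s + (M * (n⁻¹ * s + t) : ℝ≥0) := by
        rw [one_smul, ENNReal.smul_def, smul_eq_mul, ← ENNReal.coe_mul]
        congr 2
        calc n⁻¹ * (M * (s + t * n)) = M * (n⁻¹ * s + t * (n⁻¹ * n)) := by ring
          _ = M * (n⁻¹ * s + t) := by rw [inv_mul_cancel₀ hn_ne, mul_one]

theorem apply_add_le_of_convexOn (hg : ConvexOn ℝ≥0 Set.univ g) (s t : ℝ≥0) :
    g (s + t) ≤ g s + recessionSlope g * t := by
  by_cases hm : recessionSlope g = ∞
  · rcases eq_or_ne t 0 with rfl | ht <;> simp [*]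
  obtain ⟨m, hm⟩ : ∃ m : ℝ≥0, (m : ℝ≥0∞) = recessionSlope g := ⟨_, ENNReal.coe_toNNReal hm⟩
  have hlim : Tendsto (fun M : ℝ≥0 => g s + (M * t : ℝ≥0)) (nhdsWithin m (Set.Ioi m))
      (nhds (g s + (m * t : ℝ≥0))) :=
    (ENNReal.tendsto_coe.2 ((tendsto_id.mono_left nhdsWithin_le_nhds).mul_const t)).const_add _
  rw [← hm, ← ENNReal.coe_mul]
  refine ge_of_tendsto hlim (eventually_nhdsWithin_of_forall fun M hM => ?_)
  simpa using le_add_mul_of_recessionSlope_lt hg s t (hm ▸ ENNReal.coe_lt_coe.2 hM)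

/-- The perspective `(u, v) ↦ v * g (u / v)` of a function on `[0, ∞)`, extended to `v = 0` by its
recession function. -/
noncomputable def perspective (g : ℝ≥0 → ℝ≥0∞) (z : ℝ≥0 × ℝ≥0) : ℝ≥0∞ :=
  if z.2 = 0 then recessionSlope g * z.1 else z.2 * g (z.1 / z.2)

theorem measurable_perspective (hg : Measurable g) : Measurable (perspective g) :=
  Measurable.ite (measurable_snd (measurableSet_singleton 0)) (by fun_prop) (by fun_prop)

theorem perspective_smul (g : ℝ≥0 → ℝ≥0∞) (r : ℝ≥0) (z : ℝ≥0 × ℝ≥0) :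
    perspective g (r • z) = r • perspective g z := by
  rcases eq_or_ne r 0 with rfl | hr
  · simp [perspective]
  by_cases hz : z.2 = 0
  · simp [perspective, hz, ENNReal.smul_def, mul_left_comm]
  · simp [perspective, hz, hr, ENNReal.smul_def, mul_assoc, mul_div_mul_left]

theorem perspective_add_left_le (hg : ConvexOn ℝ≥0 Set.univ g) (u t v : ℝ≥0) :
    perspective g (u + t, v) ≤ perspective g (u, v) + recessionSlope g * t := by
  rcases eq_or_ne v 0 with rfl | hv
  · simp [perspective, mul_add]
  calc perspective g (u + t, v) = v * g (u / v + t / v) := by simp [perspective, hv, add_div]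
    _ ≤ v * (g (u / v) + recessionSlope g * (t / v : ℝ≥0)) := by
        gcongr; exact apply_add_le_of_convexOn hg _ _
    _ = v * g (u / v) + recessionSlope g * (v * (t / v) : ℝ≥0) := by push_cast; ring
    _ = perspective g (u, v) + recessionSlope g * t := by
        simp [perspective, hv, mul_div_cancel₀]

theorem perspective_le (hg : ConvexOn ℝ≥0 Set.univ g) (u v : ℝ≥0) :
    perspective g (u, v) ≤ g 0 * v + recessionSlope g * u := by
  have h0 : perspective g (0, v) = g 0 * v := by
    rcases eq_or_ne v 0 with rfl | hv <;> simp [perspective, mul_comm, *]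
  simpa [h0] using perspective_add_left_le hg 0 u v

theorem perspective_add_le (hg : ConvexOn ℝ≥0 Set.univ g) (y z : ℝ≥0 × ℝ≥0) :
    perspective g (y + z) ≤ perspective g y + perspective g z := by
  obtain ⟨u₁, v₁⟩ := y
  obtain ⟨u₂, v₂⟩ := z
  rcases eq_or_ne v₁ 0 with rfl | hv₁
  · simpa [perspective, add_comm] using perspective_add_left_le hg u₂ u₁ v₂
  rcases eq_or_ne v₂ 0 with rfl | hv₂
  · simpa [perspective] using perspective_add_left_le hg u₁ u₂ v₁
  have hv : v₁ + v₂ ≠ 0 := by positivity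
  have hsum : v₁ / (v₁ + v₂) + v₂ / (v₁ + v₂) = 1 := by rw [← add_div, div_self hv]
  have hmean : (v₁ / (v₁ + v₂)) • (u₁ / v₁) + (v₂ / (v₁ + v₂)) • (u₂ / v₂)
      = (u₁ + u₂) / (v₁ + v₂) := by
    simp only [smul_eq_mul]; field_simp
  have hweight (w : ℝ≥0) (x : ℝ≥0∞) :
      ((v₁ + v₂ : ℝ≥0) : ℝ≥0∞) * ((w / (v₁ + v₂)) • x) = w * x := by
    rw [ENNReal.smul_def, smul_eq_mul, ← mul_assoc, ← ENNReal.coe_mul, mul_div_cancel₀ _ hv]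
  calc perspective g ((u₁, v₁) + (u₂, v₂))
      = (v₁ + v₂ : ℝ≥0) * g ((u₁ + u₂) / (v₁ + v₂)) := by simp [perspective, hv₁]
    _ ≤ (v₁ + v₂ : ℝ≥0) * ((v₁ / (v₁ + v₂)) • g (u₁ / v₁) + (v₂ / (v₁ + v₂)) • g (u₂ / v₂)) := by
        rw [← hmean]
        gcongr
        exact hg.2 (Set.mem_univ _) (Set.mem_univ _) zero_le zero_le hsum
    _ = perspective g (u₁, v₁) + perspective g (u₂, v₂) := by
        rw [mul_add, hweight, hweight]; simp [perspective, hv₁, hv₂]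

theorem convexOn_perspective (hg : ConvexOn ℝ≥0 Set.univ g) :
    ConvexOn ℝ≥0 Set.univ (perspective g) := by
  refine ⟨convex_univ, fun y _ z _ α β _ _ _ => ?_⟩
  simpa only [perspective_smul] using perspective_add_le hg (α • y) (β • z)

theorem convexOn_perspective_left (hg : ConvexOn ℝ≥0 Set.univ g) (v : ℝ≥0) :
    ConvexOn ℝ≥0 Set.univ fun u => perspective g (u, v) := by
  refine ⟨convex_univ, fun y _ z _ α β hα hβ hαβ => ?_⟩
  simpa [← add_mul, hαβ] using
    (convexOn_perspective hg).2 (Set.mem_univ (y, v)) (Set.mem_univ (z, v)) hα hβ hαβ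

theorem convexOn_perspective_right (hg : ConvexOn ℝ≥0 Set.univ g) (u : ℝ≥0) :
    ConvexOn ℝ≥0 Set.univ fun v => perspective g (u, v) := by
  refine ⟨convex_univ, fun y _ z _ α β hα hβ hαβ => ?_⟩
  simpa [← add_mul, hαβ] using
    (convexOn_perspective hg).2 (Set.mem_univ (u, y)) (Set.mem_univ (u, z)) hα hβ hαβ

theorem recessionSlope_ne_zero (hg : ConvexOn ℝ≥0 Set.univ g) {s₀ : ℝ≥0}
    (hg₀ : ∀ s, g s = 0 ↔ s = s₀) : recessionSlope g ≠ 0 := by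
  intro hm
  have hle := apply_add_le_of_convexOn hg s₀ 1
  rw [hm, zero_mul, add_zero, (hg₀ s₀).2 rfl, nonpos_iff_eq_zero, hg₀] at hle
  simp at hle

theorem perspective_eq_zero {s₀ : ℝ≥0} (hg₀ : g s₀ = 0) (v : ℝ≥0) :
    perspective g (s₀ * v, v) = 0 := by
  rcases eq_or_ne v 0 with rfl | hv <;> simp [perspective, *]

theorem perspective_eq_zero_iff (hg : ConvexOn ℝ≥0 Set.univ g) {s₀ : ℝ≥0}
    (hg₀ : ∀ s, g s = 0 ↔ s = s₀) (u v : ℝ≥0) : perspective g (u, v) = 0 ↔ u = s₀ * v := by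
  rcases eq_or_ne v 0 with rfl | hv
  · simp [perspective, recessionSlope_ne_zero hg hg₀]
  · simp [perspective, hv, hg₀, div_eq_iff]

end Convex

section Generator

variable {f : ℝ≥0 → EReal} {g : ℝ≥0 → ℝ≥0∞} {a b : ℝ}

theorem IsGenerator.toReal_convex_combination_le (hf : IsGenerator f) {s t α β : ℝ≥0}
    (hs : f s ≠ ⊤) (ht : f t ≠ ⊤) (hαβ : α + β = 1) :
    f (α * s + β * t) ≠ ⊤ ∧
      (f (α * s + β * t)).toReal ≤ α * (f s).toReal + β * (f t).toReal := by
  have hconv := hf.convex s t α β hαβ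
  rw [← EReal.coe_toReal hs (hf.ne_bot s), ← EReal.coe_toReal ht (hf.ne_bot t)] at hconv
  have htop : f (α * s + β * t) ≠ ⊤ := (hconv.trans_lt (EReal.coe_lt_top _)).ne
  rw [← EReal.coe_toReal htop (hf.ne_bot _)] at hconv
  exact ⟨htop, by exact_mod_cast hconv⟩

theorem IsGenerator.convexOn_toReal (hf : IsGenerator f) :
    ConvexOn ℝ {x : ℝ | 0 ≤ x ∧ f x.toNNReal ≠ ⊤} fun x : ℝ => (f x.toNNReal).toReal := by
  have hcomb {x y α β : ℝ} (hx : 0 ≤ x ∧ f x.toNNReal ≠ ⊤) (hy : 0 ≤ y ∧ f y.toNNReal ≠ ⊤)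
      (hα : 0 ≤ α) (hβ : 0 ≤ β) (hαβ : α + β = 1) :
      f (α • x + β • y).toNNReal ≠ ⊤ ∧ (f (α • x + β • y).toNNReal).toReal
        ≤ α • (f x.toNNReal).toReal + β • (f y.toNNReal).toReal := by
    have hsum : α.toNNReal + β.toNNReal = 1 := by
      rw [← Real.toNNReal_add hα hβ, hαβ, Real.toNNReal_one]
    have hpoint :
        (α • x + β • y).toNNReal = α.toNNReal * x.toNNReal + β.toNNReal * y.toNNReal := by
      rw [smul_eq_mul, smul_eq_mul, Real.toNNReal_add (mul_nonneg hα hx.1) (mul_nonneg hβ hy.1),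
        Real.toNNReal_mul hα, Real.toNNReal_mul hβ]
    rw [hpoint]
    simpa [hα, hβ] using hf.toReal_convex_combination_le hx.2 hy.2 hsum
  exact ⟨fun x hx y hy α β hα hβ hαβ =>
      ⟨add_nonneg (mul_nonneg hα hx.1) (mul_nonneg hβ hy.1), (hcomb hx hy hα hβ hαβ).1⟩,
    fun x hx y hy α β hα hβ hαβ => (hcomb hx hy hα hβ hαβ).2⟩

theorem add_rightDeriv_mul_sub_le_of_convexOn {S : Set ℝ} {F : ℝ → ℝ} {x y : ℝ}
    (hF : ConvexOn ℝ S F) (hx : x ∈ interior S) (hy : y ∈ S) :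
    F x + derivWithin F (Set.Ioi x) x * (y - x) ≤ F y := by
  rcases lt_trichotomy y x with hlt | rfl | hgt
  · have hslope := (hF.slope_le_leftDeriv_of_mem_interior hy hx hlt).trans
      (hF.leftDeriv_le_rightDeriv_of_mem_interior hx)
    rw [slope_def_field, div_le_iff₀ (sub_pos.2 hlt)] at hslope
    linarith
  · simp
  · have hslope := hF.rightDeriv_le_slope_of_mem_interior hx hy hgt
    rw [slope_def_field, le_div_iff₀ (sub_pos.2 hgt)] at hslope
    linarith

theorem IsGenerator.exists_supporting_line (hf : IsGenerator f) {s₀ : ℝ≥0} (hs₀ : 0 < s₀) :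
    ∃ a b : ℝ, f s₀ = ((a * s₀ + b : ℝ) : EReal) ∧
      ∀ s : ℝ≥0, ((a * s + b : ℝ) : EReal) ≤ f s := by
  have hcoe {s : ℝ≥0} (hs : f s ≠ ⊤) : ((f s).toReal : EReal) = f s :=
    EReal.coe_toReal hs (hf.ne_bot s)
  have hint : (s₀ : ℝ) ∈ interior {x : ℝ | 0 ≤ x ∧ f x.toNNReal ≠ ⊤} := by
    have hsub : Set.Ioi (0 : ℝ) ⊆ {x : ℝ | 0 ≤ x ∧ f x.toNNReal ≠ ⊤} := fun x hx =>
      ⟨le_of_lt hx, hf.ne_top _ (Real.toNNReal_pos.2 hx)⟩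
    exact interior_maximal hsub isOpen_Ioi (by simpa using hs₀)
  set a := derivWithin (fun x : ℝ => (f x.toNNReal).toReal) (Set.Ioi (s₀ : ℝ)) s₀
  refine ⟨a, (f s₀).toReal - a * s₀, ?_, fun s => ?_⟩
  · rw [add_sub_cancel, hcoe (hf.ne_top s₀ hs₀)]
  · by_cases hs : f s = ⊤
    · simp [hs]
    have hle := add_rightDeriv_mul_sub_le_of_convexOn hf.convexOn_toReal hint (y := s)
      (by simpa using hs)
    simp only [Real.toNNReal_coe] at hle
    rw [← hcoe hs, EReal.coe_le_coe_iff]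
    linarith

theorem IsGenerator.convexOn_of_eq_add_affine (hf : IsGenerator f)
    (hfg : ∀ s, f s = (g s : EReal) + ((a * s + b : ℝ) : EReal)) : ConvexOn ℝ≥0 Set.univ g := by
  refine ⟨convex_univ, fun s _ t _ α β _ _ hαβ => ?_⟩
  have haffine : a * (α * s + β * t : ℝ≥0) + b = α * (a * s + b) + β * (a * t + b) := by
    have : (α : ℝ) + β = 1 := by exact_mod_cast hαβ
    push_cast; linear_combination -b * this
  have hmul (r : ℝ≥0) (x : ℝ≥0∞) (y : ℝ) : ((r : ℝ) : EReal) * ((x : EReal) + (y : EReal))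
      = ((r * x : ℝ≥0∞) : EReal) + ((r * y : ℝ) : EReal) := by
    rw [EReal.left_distrib_of_nonneg_of_ne_top (by exact_mod_cast r.2) (EReal.coe_ne_top _),
      EReal.coe_ennreal_mul, EReal.coe_mul]
    rfl
  have hconv := hf.convex s t α β hαβ
  rwa [hfg, hfg, hfg, hmul, hmul, add_add_add_comm, ← EReal.coe_add, ← haffine,
    (EReal.addLECancellable_coe _).add_le_add_iff_right, ← EReal.coe_ennreal_add,
    EReal.coe_ennreal_le_coe_ennreal_iff] at hconv

theorem IsGenerator.exists_eq_add_affine (hf : IsGenerator f) {s₀ : ℝ≥0} (hs₀ : 0 < s₀) :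
    ∃ (g : ℝ≥0 → ℝ≥0∞) (a b : ℝ), ConvexOn ℝ≥0 Set.univ g ∧ g s₀ = 0 ∧
      ∀ s, f s = (g s : EReal) + ((a * s + b : ℝ) : EReal) := by
  obtain ⟨a, b, heq, hle⟩ := hf.exists_supporting_line hs₀
  have hfg (s : ℝ≥0) : f s = ((f s - ((a * s + b : ℝ) : EReal)).toENNReal : EReal)
      + ((a * s + b : ℝ) : EReal) := by
    rw [EReal.coe_toENNReal, EReal.sub_add_cancel]
    exact (EReal.sub_nonneg (.inr (EReal.coe_ne_top _)) (.inr (EReal.coe_ne_bot _))).2 (hle s)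
  refine ⟨_, a, b, hf.convexOn_of_eq_add_affine hfg, ?_, hfg⟩
  rw [heq, EReal.sub_self (EReal.coe_ne_top _) (EReal.coe_ne_bot _), EReal.toENNReal_zero]

theorem coe_ennreal_div_coe (x : ℝ≥0∞) {s : ℝ≥0} (hs : 0 < s) :
    ((x / s : ℝ≥0∞) : EReal) = (x : EReal) / ((s : ℝ) : EReal) := by
  induction x with
  | top =>
    rw [ENNReal.top_div_of_ne_top ENNReal.coe_ne_top, EReal.coe_ennreal_top,
      EReal.top_div_of_pos_ne_top (by exact_mod_cast hs) (EReal.coe_ne_top _)]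
  | coe r => rw [← ENNReal.coe_div hs.ne']; exact EReal.coe_div _ _

theorem slopeAtTop_eq_recessionSlope_add
    (hfg : ∀ s, f s = (g s : EReal) + ((a * s + b : ℝ) : EReal)) :
    slopeAtTop f = (recessionSlope g : EReal) + (a : EReal) := by
  have hdiv : (fun s : ℝ≥0 => f s / ((s : ℝ) : EReal)) =ᶠ[atTop]
      (fun s : ℝ≥0 => ((g s / s : ℝ≥0∞) : EReal)) + fun s : ℝ≥0 => ((a + b / s : ℝ) : EReal) := by
    filter_upwards [eventually_gt_atTop 0] with s hs
    rw [Pi.add_apply, hfg, coe_ennreal_div_coe _ hs, EReal.div_eq_inv_mul, EReal.div_eq_inv_mul,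
      EReal.left_distrib_of_nonneg_of_ne_top (EReal.inv_nonneg_of_nonneg (by exact_mod_cast s.2))
        (by rw [← EReal.coe_inv]; exact EReal.coe_ne_top _), ← EReal.coe_inv, ← EReal.coe_mul]
    congr 2
    field_simp
  have hline : Tendsto (fun s : ℝ≥0 => ((a + b / s : ℝ) : EReal)) atTop (nhds (a : EReal)) := by
    refine (continuous_coe_real_ereal.tendsto a).comp ?_
    simpa using ((NNReal.tendsto_coe_atTop.2 tendsto_id).const_div_atTop b).const_add a
  have hcoe : (recessionSlope g : EReal)
      = limsup (fun s : ℝ≥0 => ((g s / s : ℝ≥0∞) : EReal)) atTop :=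
    EReal.coe_ennreal_strictMono.monotone.map_limsup_of_continuousAt _
      continuous_coe_ennreal_ereal.continuousAt
  rw [slopeAtTop, limsup_congr hdiv, hcoe]
  refine le_antisymm ?_ ?_
  · refine (EReal.limsup_add_le ?_ ?_).trans_eq ?_ <;> rw [hline.limsup_eq] <;> simp
  · refine le_trans ?_ EReal.le_limsup_add
    rw [hline.liminf_eq]

end Generator

section Integral

variable {Ω : Type*} [MeasurableSpace Ω]

-- For `F = x + r` this is `F⁺ - F⁻ = (r⁺ - r⁻) + x`, arranged so that `∞ - ∞` does not occur.
theorem toENNReal_add_ofReal_neg (x : ℝ≥0∞) (r : ℝ) :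
    ((x : EReal) + (r : EReal)).toENNReal + ENNReal.ofReal (-r)
      = (-((x : EReal) + (r : EReal))).toENNReal + ENNReal.ofReal r + x := by
  induction x with
  | top => simp
  | coe y =>
    change ENNReal.ofReal (y + r) + ENNReal.ofReal (-r)
      = ENNReal.ofReal (-(y + r)) + ENNReal.ofReal r + y
    have hy : (0 : ℝ) ≤ y := y.2
    simp only [ENNReal.ofReal, ← ENNReal.coe_add, ENNReal.coe_inj, ← NNReal.coe_inj,
      NNReal.coe_add, Real.coe_toNNReal']
    grind

theorem coe_sub_coe_eq_add_toReal_sub {A B C D E : ℝ≥0∞} (hB : B ≠ ∞) (hC : C ≠ ∞) (hD : D ≠ ∞)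
    (h : A + D = B + C + E) :
    (A : EReal) - (B : EReal) = (E : EReal) + ((C.toReal - D.toReal : ℝ) : EReal) := by
  lift B to ℝ≥0 using hB
  lift C to ℝ≥0 using hC
  lift D to ℝ≥0 using hD
  rcases eq_or_ne E ∞ with rfl | hE
  · have hA : A = ∞ := by simpa using h
    rw [hA, EReal.coe_ennreal_top, EReal.top_add_coe]
    exact EReal.top_sub_coe _
  · lift E to ℝ≥0 using hE
    have hA : A ≠ ∞ := fun hA => by simp [hA, ← ENNReal.coe_add] at h
    lift A to ℝ≥0 using hA
    have hreal : (A : ℝ) - B = E + (C - D) := by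
      have : (A : ℝ) + D = B + C + E := by exact_mod_cast h
      linarith
    exact congrArg Real.toEReal hreal

theorem eintegral_add_coe {ν : Measure Ω} {G : Ω → ℝ≥0∞} {r : Ω → ℝ} (hG : Measurable G)
    (hr : Measurable r) (hint : Integrable r ν) :
    eintegral ν (fun x => (G x : EReal) + (r x : EReal))
      = ((∫⁻ x, G x ∂ν : ℝ≥0∞) : EReal) + ((∫ x, r x ∂ν : ℝ) : EReal) := by
  have hneg_le (x : Ω) : (-((G x : EReal) + (r x : EReal))).toENNReal ≤ ENNReal.ofReal (-r x) := by
    rw [← EReal.real_coe_toENNReal, EReal.coe_neg]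
    refine EReal.toENNReal_le_toENNReal (EReal.neg_le_neg_iff.2 ?_)
    exact le_add_of_nonneg_left (EReal.coe_ennreal_nonneg _)
  have hsum := lintegral_congr (μ := ν) fun x => toENNReal_add_ofReal_neg (G x) (r x)
  rw [lintegral_add_right _ hr.fun_neg.ennreal_ofReal, lintegral_add_right _ hG,
    lintegral_add_right _ hr.ennreal_ofReal] at hsum
  rw [eintegral, integral_eq_lintegral_pos_part_sub_lintegral_neg_part hint]
  exact coe_sub_coe_eq_add_toReal_sub
    ((lintegral_mono hneg_le).trans_lt hint.neg.lintegral_lt_top).ne hint.lintegral_lt_top.ne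
    hint.neg.lintegral_lt_top.ne hsum

end Integral

section Density

variable {Ω : Type*} [MeasurableSpace Ω] {μ P Q : Measure Ω} {p q : Ω → ℝ≥0∞}

theorem HasDensity.lintegral_eq_one (hP : HasDensity μ P p) : ∫⁻ x, p x ∂μ = 1 := by
  have := hP.isProbabilityMeasure
  rw [← setLIntegral_univ, ← withDensity_apply _ MeasurableSet.univ, ← hP.eq_withDensity,
    measure_univ]

theorem HasDensity.ae_ne_top (hP : HasDensity μ P p) : ∀ᵐ x ∂μ, p x ≠ ∞ :=
  (ae_lt_top hP.measurable (by simp [hP.lintegral_eq_one])).mono fun _ => ne_of_lt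

theorem HasDensity.rnDeriv (hP : HasDensity μ P p) : HasDensity μ P (P.rnDeriv μ) := by
  refine ⟨hP.isProbabilityMeasure, Measure.measurable_rnDeriv _ _, ?_⟩
  have hac : P ≪ μ := hP.eq_withDensity ▸ withDensity_absolutelyContinuous μ p
  have : P.HaveLebesgueDecomposition μ :=
    hP.eq_withDensity ▸ Measure.haveLebesgueDecomposition_withDensity μ hP.measurable
  exact (Measure.withDensity_rnDeriv_eq P μ hac).symm

theorem HasDensity.ae_eq {p' : Ω → ℝ≥0∞} (hP : HasDensity μ P p) (hP' : HasDensity μ P p') :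
    p =ᵐ[μ] p' := by
  rw [← withDensity_eq_iff hP.measurable.aemeasurable hP'.measurable.aemeasurable
    (by simp [hP.lintegral_eq_one]), ← hP.eq_withDensity, ← hP'.eq_withDensity]

theorem HasDensity.eq_of_ae_eq (hP : HasDensity μ P p) (hQ : HasDensity μ Q q)
    (hpq : p =ᵐ[μ] q) : P = Q := by
  rw [hP.eq_withDensity, hQ.eq_withDensity, withDensity_congr_ae hpq]

theorem HasDensity.eq_of_ae_le (hP : HasDensity μ P p) (hQ : HasDensity μ Q q)
    (hpq : p ≤ᵐ[μ] q) : P = Q :=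
  hP.eq_of_ae_eq hQ <| ae_eq_of_ae_le_of_lintegral_le hpq (by simp [hP.lintegral_eq_one])
    hQ.measurable.aemeasurable (by rw [hP.lintegral_eq_one, hQ.lintegral_eq_one])

theorem HasDensity.restrict_pos (hQ : HasDensity μ Q q) : Q.restrict {x | 0 < q x} = Q := by
  refine Measure.restrict_eq_self_of_ae_mem ?_
  rw [hQ.eq_withDensity, ae_withDensity_iff hQ.measurable]
  exact ae_of_all _ fun _ => pos_iff_ne_zero.2

theorem HasDensity.lintegral_eq_lintegral_mul (hQ : HasDensity μ Q q) {G : Ω → ℝ≥0∞}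
    (hG : Measurable G) : ∫⁻ x, G x ∂Q = ∫⁻ x, q x * G x ∂μ := by
  rw [hQ.eq_withDensity, lintegral_withDensity_eq_lintegral_mul _ hQ.measurable hG]
  rfl

theorem HasDensity.apply_eq_setLIntegral (hP : HasDensity μ P p) {s : Set Ω}
    (hs : MeasurableSet s) : P s = ∫⁻ x in s, p x ∂μ := by
  rw [hP.eq_withDensity, withDensity_apply _ hs]

end Density

section Divergence

variable {Ω : Type*} [MeasurableSpace Ω] {μ P Q : Measure Ω} {p q : Ω → ℝ≥0∞}
  {f : ℝ≥0 → EReal} {g : ℝ≥0 → ℝ≥0∞} {a b : ℝ}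

theorem HasDensity.lintegral_div (hP : HasDensity μ P p) (hQ : HasDensity μ Q q) :
    ∫⁻ x, p x / q x ∂Q = P {x | q x = 0}ᶜ := by
  have hset : MeasurableSet {x | q x = 0}ᶜ := (hQ.measurable (measurableSet_singleton 0)).compl
  rw [hQ.lintegral_eq_lintegral_mul (hP.measurable.fun_div hQ.measurable),
    hP.apply_eq_setLIntegral hset, ← lintegral_indicator hset]
  refine lintegral_congr_ae ?_
  filter_upwards [hQ.ae_ne_top] with x hq
  by_cases hx : q x = 0 <;> simp [hx, ENNReal.mul_div_cancel, hq]

theorem HasDensity.integrable_div (hP : HasDensity μ P p) (hQ : HasDensity μ Q q) :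
    Integrable (fun x => (p x / q x).toReal) Q := by
  have := hP.isProbabilityMeasure
  refine integrable_toReal_of_lintegral_ne_top (hP.measurable.div hQ.measurable).aemeasurable ?_
  rw [hP.lintegral_div hQ]
  exact measure_ne_top _ _

theorem HasDensity.integral_div (hP : HasDensity μ P p) (hQ : HasDensity μ Q q) :
    ∫ x, (p x / q x).toReal ∂Q = P.real {x | q x = 0}ᶜ := by
  have := hP.isProbabilityMeasure
  have hmeas : Measurable fun x => p x / q x := hP.measurable.div hQ.measurable
  have hlint := hP.lintegral_div hQ
  rw [integral_toReal hmeas.aemeasurable (ae_lt_top hmeas (hlint ▸ measure_ne_top _ _)), hlint,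
    measureReal_def]

theorem HasDensity.eintegral_comp_div (hP : HasDensity μ P p) (hQ : HasDensity μ Q q)
    (hg : Measurable g) (hfg : ∀ s, f s = (g s : EReal) + ((a * s + b : ℝ) : EReal)) :
    eintegral Q (fun x => f (p x / q x).toNNReal)
      = ((∫⁻ x, q x * g (p x / q x).toNNReal ∂μ : ℝ≥0∞) : EReal)
        + ((a * P.real {x | q x = 0}ᶜ + b : ℝ) : EReal) := by
  have := hQ.isProbabilityMeasure
  have hmeas : Measurable fun x => p x / q x := hP.measurable.div hQ.measurable
  have hG : Measurable fun x => g (p x / q x).toNNReal := hg.comp hmeas.ennreal_toNNReal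
  have hint := (hP.integrable_div hQ).const_mul a
  simp only [hfg]
  rw [← hQ.lintegral_eq_lintegral_mul hG, ← hP.integral_div hQ, ← integral_const_mul]
  refine (eintegral_add_coe hG
    ((hmeas.ennreal_toReal.const_mul a).add_const b) (hint.add (integrable_const b))).trans ?_
  congr 2
  rw [integral_add hint (integrable_const b)]
  simp

theorem HasDensity.lintegral_perspective (hP : HasDensity μ P p) (hQ : HasDensity μ Q q)
    (g : ℝ≥0 → ℝ≥0∞) :
    ∫⁻ x, perspective g ((p x).toNNReal, (q x).toNNReal) ∂μ
      = ∫⁻ x, q x * g (p x / q x).toNNReal ∂μ + recessionSlope g * P {x | q x = 0} := by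
  have hset : MeasurableSet {x | q x = 0} := hQ.measurable (measurableSet_singleton 0)
  rw [hP.apply_eq_setLIntegral hset, ← lintegral_const_mul _ hP.measurable,
    ← lintegral_indicator hset,
    ← lintegral_add_right _ ((hP.measurable.const_mul _).indicator hset)]
  refine lintegral_congr_ae ?_
  filter_upwards [hP.ae_ne_top, hQ.ae_ne_top] with x hp hq
  by_cases hx : q x = 0
  · simp [perspective, hx, hp]
  · simp [perspective, hx, hq, ENNReal.toNNReal_eq_zero_iff, ENNReal.toNNReal_div]

theorem HasDensity.fDiv_eq_lintegral_perspective_add (hP : HasDensity μ P p) (hQ : HasDensity μ Q q)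
    (hg : Measurable g) (hfg : ∀ s, f s = (g s : EReal) + ((a * s + b : ℝ) : EReal)) :
    fDiv μ f P Q
      = ((∫⁻ x, perspective g ((p x).toNNReal, (q x).toNNReal) ∂μ : ℝ≥0∞) : EReal)
        + ((a + b : ℝ) : EReal) := by
  have := hP.isProbabilityMeasure
  have hset : MeasurableSet {x | Q.rnDeriv μ x = 0} :=
    Measure.measurable_rnDeriv _ _ (measurableSet_singleton 0)
  have hcongr : ∫⁻ x, perspective g ((p x).toNNReal, (q x).toNNReal) ∂μ
      = ∫⁻ x, perspective g ((P.rnDeriv μ x).toNNReal, (Q.rnDeriv μ x).toNNReal) ∂μ := by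
    refine lintegral_congr_ae ?_
    filter_upwards [hP.ae_eq hP.rnDeriv, hQ.ae_eq hQ.rnDeriv] with x hp hq
    rw [hp, hq]
  have hslope : slopeAtTop f * ((P {x | Q.rnDeriv μ x = 0} : ℝ≥0∞) : EReal)
      = ((recessionSlope g * P {x | Q.rnDeriv μ x = 0} : ℝ≥0∞) : EReal)
        + ((a * P.real {x | Q.rnDeriv μ x = 0} : ℝ) : EReal) := by
    rw [slopeAtTop_eq_recessionSlope_add hfg, EReal.coe_ennreal_mul, EReal.coe_mul,
      measureReal_def, EReal.coe_ennreal_toReal (measure_ne_top _ _)]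
    exact EReal.right_distrib_of_nonneg_of_ne_top (EReal.coe_ennreal_nonneg _) (by simp) _ _
  rw [hcongr, hP.rnDeriv.lintegral_perspective hQ.rnDeriv, fDiv, hQ.rnDeriv.restrict_pos,
    hP.rnDeriv.eintegral_comp_div hQ.rnDeriv hg hfg, hslope, add_add_add_comm,
    EReal.coe_ennreal_add, ← EReal.coe_add, probReal_compl_eq_one_sub hset]
  congr 2
  ring

theorem fDiv_le_fDiv_iff {P' Q' : Measure Ω} {p' q' : Ω → ℝ≥0∞} (hP : HasDensity μ P p)
    (hQ : HasDensity μ Q q) (hP' : HasDensity μ P' p') (hQ' : HasDensity μ Q' q')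
    (hg : Measurable g) (hfg : ∀ s, f s = (g s : EReal) + ((a * s + b : ℝ) : EReal)) :
    fDiv μ f P Q ≤ fDiv μ f P' Q' ↔
      ∫⁻ x, perspective g ((p x).toNNReal, (q x).toNNReal) ∂μ
        ≤ ∫⁻ x, perspective g ((p' x).toNNReal, (q' x).toNNReal) ∂μ := by
  rw [hP.fDiv_eq_lintegral_perspective_add hQ hg hfg,
    hP'.fDiv_eq_lintegral_perspective_add hQ' hg hfg,
    (EReal.addLECancellable_coe _).add_le_add_iff_right, EReal.coe_ennreal_le_coe_ennreal_iff]

theorem HasDensity.lintegral_perspective_le (hP : HasDensity μ P p) (hQ : HasDensity μ Q q)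
    (hg : ConvexOn ℝ≥0 Set.univ g) :
    ∫⁻ x, perspective g ((p x).toNNReal, (q x).toNNReal) ∂μ ≤ g 0 + recessionSlope g := by
  calc ∫⁻ x, perspective g ((p x).toNNReal, (q x).toNNReal) ∂μ
      ≤ ∫⁻ x, (g 0 * q x + recessionSlope g * p x) ∂μ := by
        refine lintegral_mono fun x => (perspective_le hg _ _).trans ?_
        gcongr <;> exact ENNReal.coe_toNNReal_le_self
    _ = g 0 + recessionSlope g := by
        rw [lintegral_add_right _ (hP.measurable.const_mul _), lintegral_const_mul _ hQ.measurable,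
          lintegral_const_mul _ hP.measurable, hP.lintegral_eq_one, hQ.lintegral_eq_one, mul_one,
          mul_one]

end Divergence

section Clip

variable {Ω : Type*} {qL qU p q : Ω → ℝ≥0∞} {c : ℝ≥0}

theorem monotone_clip (qL qU p : Ω → ℝ≥0∞) : Monotone (clip qL qU p) := fun _ _ hcd x => by
  simp only [clip]
  gcongr

theorem toNNReal_clip_mem_segment {x : Ω} (hL : qL x ≤ q x) (hU : q x ≤ qU x) (hp : p x ≠ ∞)
    (hq : q x ≠ ∞) :
    (clip qL qU p c x).toNNReal ∈ segment ℝ≥0 (c * (p x).toNNReal) (q x).toNNReal := by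
  have hcp : c * p x ≠ ∞ := ENNReal.mul_ne_top ENNReal.coe_ne_top hp
  have hbetween : min (c * p x) (q x) ≤ clip qL qU p c x ∧
      clip qL qU p c x ≤ max (c * p x) (q x) := by
    simp only [clip]
    grind
  have hclip : clip qL qU p c x ≠ ∞ := (hbetween.2.trans_lt (by finiteness)).ne
  have hmul : c * (p x).toNNReal = (c * p x).toNNReal := by simp
  rw [NNReal.segment_eq_uIcc, hmul, Set.mem_uIcc]
  rcases le_total (c * p x) (q x) with h | h
  · rw [min_eq_left h, max_eq_right h] at hbetween
    exact .inl ⟨ENNReal.toNNReal_mono hclip hbetween.1, ENNReal.toNNReal_mono hq hbetween.2⟩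
  · rw [min_eq_right h, max_eq_left h] at hbetween
    exact .inr ⟨ENNReal.toNNReal_mono hclip hbetween.1, ENNReal.toNNReal_mono hcp hbetween.2⟩

variable [MeasurableSpace Ω] {μ P Q Q' : Measure Ω} {h : ℝ≥0 → ℝ≥0 → ℝ≥0∞}

theorem clip_mem_band (hle : ∀ x, qL x ≤ qU x) (hQ : HasDensity μ Q (clip qL qU p c)) :
    Q ∈ band μ qL qU :=
  ⟨_, hQ, ae_of_all _ fun x => ⟨le_min (hle x) (le_max_right _ _), min_le_left _ _⟩⟩

theorem eq_of_hasDensity_clip {c' : ℝ≥0} (hQ : HasDensity μ Q (clip qL qU p c))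
    (hQ' : HasDensity μ Q' (clip qL qU p c')) : Q = Q' := by
  rcases le_total c c' with hcc' | hcc'
  · exact hQ.eq_of_ae_le hQ' (ae_of_all _ (monotone_clip qL qU p hcc'))
  · exact (hQ'.eq_of_ae_le hQ (ae_of_all _ (monotone_clip qL qU p hcc'))).symm

theorem band_eq_singleton_of_hasDensity_clip_zero (hle : ∀ x, qL x ≤ qU x)
    (hQ : HasDensity μ Q (clip qL qU p 0)) : band μ qL qU = {Q} := by
  refine Set.eq_singleton_iff_unique_mem.2 ⟨clip_mem_band hle hQ, ?_⟩
  rintro Q' ⟨q, hQ', hq⟩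
  refine (hQ.eq_of_ae_le hQ' (hq.mono fun x hx => le_trans ?_ hx.1)).symm
  simp [clip]

theorem ae_apply_clip_le (hP : HasDensity μ P p) (hQ' : HasDensity μ Q' q)
    (hq : ∀ᵐ x ∂μ, qL x ≤ q x ∧ q x ≤ qU x) (hh : ∀ u, ConvexOn ℝ≥0 Set.univ (h u))
    (hh₀ : ∀ u, h u (c * u) = 0) :
    ∀ᵐ x ∂μ, h (p x).toNNReal (clip qL qU p c x).toNNReal
      ≤ h (p x).toNNReal (q x).toNNReal := by
  filter_upwards [hq, hP.ae_ne_top, hQ'.ae_ne_top] with x hx hp_fin hq_fin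
  exact le_of_convexOn_of_mem_segment (hh _) (hh₀ _)
    (toNNReal_clip_mem_segment hx.1 hx.2 hp_fin hq_fin)

theorem eq_of_lintegral_le_lintegral_clip (hP : HasDensity μ P p)
    (hQ : HasDensity μ Q (clip qL qU p c)) (hQ' : HasDensity μ Q' q)
    (hq : ∀ᵐ x ∂μ, qL x ≤ q x ∧ q x ≤ qU x) (hh : ∀ u, ConvexOn ℝ≥0 Set.univ (h u))
    (hh₀ : ∀ u v, h u v = 0 ↔ v = c * u) (hmeas : Measurable fun z : ℝ≥0 × ℝ≥0 => h z.1 z.2)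
    (hfin : ∫⁻ x, h (p x).toNNReal (clip qL qU p c x).toNNReal ∂μ ≠ ∞)
    (hle : ∫⁻ x, h (p x).toNNReal (q x).toNNReal ∂μ
      ≤ ∫⁻ x, h (p x).toNNReal (clip qL qU p c x).toNNReal ∂μ) : Q' = Q := by
  have hmeas_comp {r : Ω → ℝ≥0∞} (hr : Measurable r) :
      Measurable fun x => h (p x).toNNReal (r x).toNNReal :=
    hmeas.comp (hP.measurable.ennreal_toNNReal.prodMk hr.ennreal_toNNReal)
  have hae := ae_eq_of_ae_le_of_lintegral_le
    (ae_apply_clip_le hP hQ' hq hh fun u => (hh₀ u _).2 rfl) hfin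
    (hmeas_comp hQ'.measurable).aemeasurable hle
  refine hQ'.eq_of_ae_eq hQ ?_
  filter_upwards [hae, hq, hP.ae_ne_top, hQ.ae_ne_top, hQ'.ae_ne_top,
    ae_lt_top (hmeas_comp hQ.measurable) hfin] with x heq hx hp_fin hclip_fin hq_fin hlt
  have hclip_eq : (clip qL qU p c x).toNNReal = (q x).toNNReal :=
    eq_of_convexOn_of_mem_segment_of_le (hh _) (hh₀ _)
      (toNNReal_clip_mem_segment hx.1 hx.2 hp_fin hq_fin) hlt.ne heq.ge
  exact ((ENNReal.toNNReal_eq_toNNReal_iff' hclip_fin hq_fin).1 hclip_eq).symm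

end Clip

section Minimization

variable {Ω : Type*} [MeasurableSpace Ω] {μ P Q Q' : Measure Ω} {qL qU p : Ω → ℝ≥0∞} {c : ℝ≥0}
  {f : ℝ≥0 → EReal} {g : ℝ≥0 → ℝ≥0∞} {a b : ℝ}

theorem isMinOn_fDiv_right (hc : 0 < c) (hP : HasDensity μ P p)
    (hQ : HasDensity μ Q (clip qL qU p c)) (hf : IsGenerator f) :
    IsMinOn (fun Q' => fDiv μ f P Q') (band μ qL qU) Q := by
  rintro Q' ⟨q, hQ', hq⟩
  obtain ⟨g, a, b, hg, hg₀, hfg⟩ := hf.exists_eq_add_affine (inv_pos.2 hc)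
  refine (fDiv_le_fDiv_iff hP hQ hP hQ' (measurable_of_convexOn hg) hfg).2 (lintegral_mono_ae ?_)
  refine ae_apply_clip_le (h := fun u v => perspective g (u, v)) hP hQ' hq
    (convexOn_perspective_right hg) fun u => ?_
  simpa [hc.ne'] using perspective_eq_zero hg₀ (c * u)

theorem isMinOn_fDiv_left (hc : 0 < c) (hP : HasDensity μ P p)
    (hQ : HasDensity μ Q (clip qL qU p c)) (hf : IsGenerator f) :
    IsMinOn (fun Q' => fDiv μ f Q' P) (band μ qL qU) Q := by
  rintro Q' ⟨q, hQ', hq⟩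
  obtain ⟨g, a, b, hg, hg₀, hfg⟩ := hf.exists_eq_add_affine hc
  refine (fDiv_le_fDiv_iff hQ hP hQ' hP (measurable_of_convexOn hg) hfg).2 (lintegral_mono_ae ?_)
  exact ae_apply_clip_le (h := fun u v => perspective g (v, u)) hP hQ' hq
    (convexOn_perspective_left hg) (perspective_eq_zero hg₀)

theorem eq_of_fDiv_right_le (hc : 0 < c) (hP : HasDensity μ P p)
    (hQ : HasDensity μ Q (clip qL qU p c)) (hQ' : Q' ∈ band μ qL qU)
    (hg : ConvexOn ℝ≥0 Set.univ g) (hg₀ : ∀ s, g s = 0 ↔ s = c⁻¹) (hg_zero : g 0 ≠ ∞)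
    (hslope : recessionSlope g ≠ ∞) (hfg : ∀ s, f s = (g s : EReal) + ((a * s + b : ℝ) : EReal))
    (hle : fDiv μ f P Q' ≤ fDiv μ f P Q) : Q' = Q := by
  obtain ⟨q, hQ', hq⟩ := hQ'
  have hmeas := measurable_of_convexOn hg
  have hfin := (hP.lintegral_perspective_le hQ hg).trans_lt (by finiteness)
  refine eq_of_lintegral_le_lintegral_clip (h := fun u v => perspective g (u, v)) hP hQ hQ' hq
    (convexOn_perspective_right hg) (fun u v => ?_) (measurable_perspective hmeas) hfin.ne
    ((fDiv_le_fDiv_iff hP hQ' hP hQ hmeas hfg).1 hle)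
  rw [perspective_eq_zero_iff hg hg₀, eq_inv_mul_iff_mul_eq₀ hc.ne', eq_comm]

theorem eq_of_fDiv_left_le (hP : HasDensity μ P p)
    (hQ : HasDensity μ Q (clip qL qU p c)) (hQ' : Q' ∈ band μ qL qU)
    (hg : ConvexOn ℝ≥0 Set.univ g) (hg₀ : ∀ s, g s = 0 ↔ s = c) (hg_zero : g 0 ≠ ∞)
    (hslope : recessionSlope g ≠ ∞) (hfg : ∀ s, f s = (g s : EReal) + ((a * s + b : ℝ) : EReal))
    (hle : fDiv μ f Q' P ≤ fDiv μ f Q P) : Q' = Q := by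
  obtain ⟨q, hQ', hq⟩ := hQ'
  have hmeas := measurable_of_convexOn hg
  have hfin := (hQ.lintegral_perspective_le hP hg).trans_lt (by finiteness)
  exact eq_of_lintegral_le_lintegral_clip (h := fun u v => perspective g (v, u)) hP hQ hQ' hq
    (convexOn_perspective_left hg) (fun u v => perspective_eq_zero_iff hg hg₀ v u)
    ((measurable_perspective hmeas).comp measurable_swap) hfin.ne
    ((fDiv_le_fDiv_iff hQ' hP hQ hP hmeas hfg).1 hle)

/-- The generator `|s - s₀| - |1 - s₀|`, which singles out the minimizer of its divergence. -/
noncomputable def absGenerator (s₀ s : ℝ≥0) : EReal :=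
  ((dist s s₀ - dist 1 s₀ : ℝ) : EReal)

theorem isGenerator_absGenerator (s₀ : ℝ≥0) : IsGenerator (absGenerator s₀) where
  ne_bot _ := EReal.coe_ne_bot _
  ne_top _ _ := EReal.coe_ne_top _
  convex s t α β hαβ := by
    have hsum : (α : ℝ) + β = 1 := by exact_mod_cast hαβ
    have hdist : dist (α * s + β * t) s₀ ≤ α * dist s s₀ + β * dist t s₀ := by
      have hsub : ((α * s + β * t : ℝ≥0) : ℝ) - s₀ = α * (s - s₀) + β * (t - s₀) := by
        push_cast; linear_combination (s₀ : ℝ) * hsum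
      simpa only [NNReal.dist_eq, hsub, abs_mul, NNReal.abs_eq] using
        abs_add_le ((α : ℝ) * (s - s₀)) (β * (t - s₀))
    simp only [absGenerator, ← EReal.coe_mul, ← EReal.coe_add, EReal.coe_le_coe_iff]
    linear_combination hdist + dist 1 s₀ * hsum
  map_one := by simp [absGenerator]

theorem absGenerator_eq (s₀ s : ℝ≥0) :
    absGenerator s₀ s
      = ((nndist s s₀ : ℝ≥0∞) : EReal) + (((0 : ℝ) * s + -dist 1 s₀ : ℝ) : EReal) := by
  change _ = ((dist s s₀ : ℝ) : EReal) + _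
  rw [absGenerator, ← EReal.coe_add, zero_mul, zero_add, sub_eq_add_neg]

theorem recessionSlope_nndist_ne_top (s₀ : ℝ≥0) :
    recessionSlope (fun s => (nndist s s₀ : ℝ≥0∞)) ≠ ∞ := by
  refine ne_top_of_le_ne_top (b := ((1 + s₀ : ℝ≥0) : ℝ≥0∞)) ENNReal.coe_ne_top
    (limsup_le_of_le (h := ?_))
  filter_upwards [eventually_ge_atTop 1] with s hs
  refine ENNReal.div_le_of_le_mul ?_
  have hle : nndist s s₀ ≤ (1 + s₀) * s := by
    calc nndist s s₀ ≤ nndist s 0 + nndist s₀ 0 := nndist_triangle_right _ _ _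
      _ = s + s₀ * 1 := by simp
      _ ≤ s + s₀ * s := by gcongr
      _ = (1 + s₀) * s := by ring
  exact_mod_cast hle

theorem eq_of_fDiv_absGenerator_right_le (hc : 0 < c) (hP : HasDensity μ P p)
    (hQ : HasDensity μ Q (clip qL qU p c)) (hQ' : Q' ∈ band μ qL qU)
    (hle : fDiv μ (absGenerator c⁻¹) P Q' ≤ fDiv μ (absGenerator c⁻¹) P Q) : Q' = Q :=
  eq_of_fDiv_right_le hc hP hQ hQ'
    ((isGenerator_absGenerator _).convexOn_of_eq_add_affine (absGenerator_eq _)) (by simp)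
    ENNReal.coe_ne_top (recessionSlope_nndist_ne_top _) (absGenerator_eq _) hle

theorem eq_of_fDiv_absGenerator_left_le (hP : HasDensity μ P p)
    (hQ : HasDensity μ Q (clip qL qU p c)) (hQ' : Q' ∈ band μ qL qU)
    (hle : fDiv μ (absGenerator c) Q' P ≤ fDiv μ (absGenerator c) Q P) : Q' = Q :=
  eq_of_fDiv_left_le hP hQ hQ'
    ((isGenerator_absGenerator _).convexOn_of_eq_add_affine (absGenerator_eq _)) (by simp)
    ENNReal.coe_ne_top (recessionSlope_nndist_ne_top _) (absGenerator_eq _) hle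

end Minimization
end BandModel

theorem mainTheorem5 {Ω : Type*} [MeasurableSpace Ω] (μ : Measure Ω)
    (qL qU : Ω → ℝ≥0∞) (hband : BandModel.IsBand μ qL qU)
    (P : Measure Ω) (p : Ω → ℝ≥0∞) (hP : BandModel.HasDensity μ P p)
    (c : ℝ≥0) (Qstar : Measure Ω)
    (hQ : BandModel.HasDensity μ Qstar (BandModel.clip qL qU p c)) :
    -- any distribution of this form, for whatever constant, is the same one
    (∀ (c' : ℝ≥0) (Q : Measure Ω),
        BandModel.HasDensity μ Q (BandModel.clip qL qU p c') → Q = Qstar) ∧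
    -- it lies in the band and minimizes both divergences there, for all convex `f`
    Qstar ∈ BandModel.band μ qL qU ∧
    (∀ f : ℝ≥0 → EReal, BandModel.IsGenerator f →
        IsMinOn (fun Q => BandModel.fDiv μ f P Q) (BandModel.band μ qL qU) Qstar ∧
        IsMinOn (fun Q => BandModel.fDiv μ f Q P) (BandModel.band μ qL qU) Qstar) ∧
    -- it is the only distribution in the band with either of these minimality properties
    (∀ Q ∈ BandModel.band μ qL qU,
        (∀ f : ℝ≥0 → EReal, BandModel.IsGenerator f →
          IsMinOn (fun Q' => BandModel.fDiv μ f P Q') (BandModel.band μ qL qU) Q) →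
        Q = Qstar) ∧
    (∀ Q ∈ BandModel.band μ qL qU,
        (∀ f : ℝ≥0 → EReal, BandModel.IsGenerator f →
          IsMinOn (fun Q' => BandModel.fDiv μ f Q' P) (BandModel.band μ qL qU) Q) →
        Q = Qstar) := by
  have hmem := BandModel.clip_mem_band hband.le hQ
  refine ⟨fun c' Q hQ' => BandModel.eq_of_hasDensity_clip hQ' hQ, hmem, ?_⟩
  rcases eq_zero_or_pos c with rfl | hc
  · rw [BandModel.band_eq_singleton_of_hasDensity_clip_zero hband.le hQ]
    simp [isMinOn_iff]
  · exact ⟨fun f hf => ⟨BandModel.isMinOn_fDiv_right hc hP hQ hf,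
        BandModel.isMinOn_fDiv_left hc hP hQ hf⟩,
      fun Q hQ' hmin => BandModel.eq_of_fDiv_absGenerator_right_le hc hP hQ hQ'
        (hmin _ (BandModel.isGenerator_absGenerator _) hmem),
      fun Q hQ' hmin => BandModel.eq_of_fDiv_absGenerator_left_le hP hQ hQ'
        (hmin _ (BandModel.isGenerator_absGenerator _) hmem)⟩
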